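/- Work on the triangular lattice of unit equilateral triangles with horizontal lattice lines. Call two unit triangles adjacent if they share an edge; a lozenge is the union of two adjacent unit triangles. A tiling of a finite union $R$ of unit triangles is a set of lozenges contained in $R$ that cover $R$ and have pairwise disjoint interiors, and $R$ is tileable if it has a tiling. Let $a,b,n\ge 0$ be integers and let $(u_i)_{i=1}^n$ be integers with $1\le u_1<u_2<\dots<u_n\le b+2n$. Let $H$ be the equiangular hexagon (possibly degenerate) whose sides lie on lattice lines and have lengths $2a,\ b+2n,\ b,\ 2a+2n,\ b,\ b+2n$, clockwise starting from the northern side. Along each of the northeastern and the northwestern side, number the unit triangles of $H$ that share an edge with this side $1,2,\dots,b+2n$ from north to south. The dented half-hexagon $V_{a,b,n,(u_i)}$ is obtained from $H$ by removing the triangles with numbers $u_1,\dots,u_n$ along the northeastern side and those with numbers $u_1,\dots,u_n$ along the northwestern side, and then keeping only the unit triangles whose interiors lie strictly west of the vertical symmetry axis of $H$. Then $V_{a,b,n,(u_i)}$ is tileable if and only if $2i\le u_i$ for all $i\in\{1,\dots,n\}$. -/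

import Mathlib

namespace Lozenge

/-- A unit triangle of the triangular lattice. The pair `(i, j) : ℤ × ℤ` stands for the lattice
point `i • e + j • s` of the plane, where `e = (1, 0)` is the unit vector pointing east and
`s = (-1/2, -√3/2)` is the unit vector pointing in direction 240 degrees (southwest); hence `e + s`
is the unit vector in direction 300 degrees (southeast), and `j` counts horizontal lattice lines
southwards. `up i j` is the up-pointing triangle with apex `(i, j)`, and `down i j` is the
down-pointing triangle whose horizontal edge runs from `(i, j)` east to `(i + 1, j)`. -/
inductive Triangle : Type where
  | up (i j : ℤ) : Triangle
  | down (i j : ℤ) : Triangle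

/-- The three corners of a unit triangle. -/
def Triangle.vertices : Triangle → Finset (ℤ × ℤ)
  | .up i j => {(i, j), (i, j + 1), (i + 1, j + 1)}
  | .down i j => {(i, j), (i + 1, j), (i + 1, j + 1)}

/-- Two unit triangles are adjacent if they share an edge, that is, exactly two corners. -/
def Adjacent (p q : Triangle) : Prop :=
  (p.vertices ∩ q.vertices).card = 2

/-- A lozenge is the union of two adjacent unit triangles (encoded by the set of the two). -/
def IsLozenge (L : Set Triangle) : Prop :=
  ∃ p q : Triangle, Adjacent p q ∧ L = {p, q}

/-- A (lozenge) tiling of a region `R`, a union of unit triangles: a family of lozenges within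
`R`, pairwise without common triangle, that covers `R`. -/
structure IsTiling (R : Set Triangle) (T : Set (Set Triangle)) : Prop where
  isLozenge : ∀ L ∈ T, IsLozenge L
  subset : ∀ L ∈ T, L ⊆ R
  pairwiseDisjoint : T.Pairwise Disjoint
  covers : ∀ p ∈ R, ∃ L ∈ T, p ∈ L

/-- A region is tileable if it has a tiling. -/
def Tileable (R : Set Triangle) : Prop :=
  ∃ T : Set (Set Triangle), IsTiling R T

/-- The lattice points of the equiangular hexagon with side lengths
`a, b + t, c, a + t, b, c + t` clockwise from the northern side. The northwestern corner is the
origin; the six conditions say that the point lies on the inner side of, in this order, the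
northern, northeastern, southeastern, southern, southwestern and northwestern side. -/
def InHexagon (a b c t : ℕ) (p : ℤ × ℤ) : Prop :=
  0 ≤ p.2 ∧ p.1 ≤ a + p.2 ∧ p.1 ≤ a + b + t ∧ p.2 ≤ b + c + t ∧ p.2 ≤ p.1 + (c + t) ∧ 0 ≤ p.1

/-- The equiangular hexagon with side lengths `a, b + t, c, a + t, b, c + t` clockwise from the
northern side, as a region. -/
def hexagon (a b c t : ℕ) : Set Triangle :=
  {p | ∀ x ∈ p.vertices, InHexagon a b c t x}

/-- The `k`th unit triangle (`k ≥ 1`, counted from the north) among those in the hexagon that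
share an edge with its northeastern side; this side runs through the points `(a + l, l)`. -/
def neTriangle (a k : ℕ) : Triangle :=
  .up (a + k - 1) (k - 1)

/-- The `k`th unit triangle (`k ≥ 1`, counted from the north) among those in the hexagon that
share an edge with its northwestern side; this side runs through the points `(0, l)`. -/
def nwTriangle (k : ℕ) : Triangle :=
  .up 0 (k - 1)

/-- The dented hexagon: the triangles at positions `u i` along the northeastern side and those at
positions `v j` along the northwestern side are removed. -/
def dentedHexagon (a b c t : ℕ) {m n : ℕ} (u : Fin m → ℕ) (v : Fin n → ℕ) : Set Triangle :=
  {p ∈ hexagon a b c t | (∀ i, p ≠ neTriangle a (u i)) ∧ ∀ j, p ≠ nwTriangle (v j)}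

/-- The dented half-hexagon `V_{a,b,t,u}`: the triangles of the vertically symmetric dented hexagon
`H_{2a,b,b,2t,u,u}` whose interior lies strictly west of the vertical symmetry axis. The axis
passes through the midpoint `(a, 0)` of the northern side, and the horizontal coordinate of a
lattice point `(i, j)` in the plane is `i - j / 2`, so the axis is the line `2 * i - j = 2 * a`. -/
def dentedHalfHexagon (a b t : ℕ) {n : ℕ} (u : Fin n → ℕ) : Set Triangle :=
  {p ∈ dentedHexagon (2 * a) b b (2 * t) u u | ∀ x ∈ p.vertices, 2 * x.1 - x.2 ≤ 2 * (a : ℤ)}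

end Lozenge

/-!
Every lozenge consists of one up-pointing and one down-pointing triangle, so a tiling is a perfect
matching between the two kinds. Write `N = b + 2 * n`, and let row `j` be the strip between the
horizontal lattice lines `j` and `j + 1`.

*Necessity.* An up-pointing triangle is adjacent to two down-pointing ones in its own row and to one
in the row below. Hence in a tiling the up-pointing triangles in the rows from `k = u i` on are
matched injectively with down-pointing triangles in these rows. Counting both kinds row by row, the
difference telescopes to `i + 1 - k / 2` (the `n - i - 1` dents in these rows being taken into
account), so `2 * (i + 1) ≤ u i`; this is `two_mul_le_of_tileable`. Counting the rows below the dent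
avoids the rows above it, where the first dent may miss the half-hexagon altogether
(if `a = 0` and `u 0 = 1`).

*Sufficiency.* Let `front j` be `a` plus the number of dents above line `j`, plus `j - N` if `j` is
beyond `N`. Put a vertical lozenge across line `j` at exactly the positions `i ≥ front j` available
there, and match the remaining triangles of each row along that row: straight if
`front (j + 1) = front j`, and shifted by one if `front (j + 1) = front j + 1`. This matching
`rowMatching` is an involution for any front, and it stays inside the region because
`2 * front j ≤ 2 * a + j`, which is what the inequalities `2 * (i + 1) ≤ u i` provide.
-/

namespace Lozenge

/-! ### Adjacency and tilings as matchings -/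

lemma Adjacent.symm {p q : Triangle} (h : Adjacent p q) : Adjacent q p := by
  rw [Adjacent, Finset.inter_comm]; exact h

lemma Adjacent.ne {p q : Triangle} (h : Adjacent p q) : p ≠ q := by
  rintro rfl
  rw [Adjacent, Finset.inter_self] at h
  cases p <;> simp [Triangle.vertices] at h

lemma adjacent_up_down (i j : ℤ) : Adjacent (.up i j) (.down i j) := by
  refine Finset.card_eq_two.2 ⟨(i, j), (i + 1, j + 1), by simp, ?_⟩
  ext ⟨x, y⟩
  simp only [Triangle.vertices, Finset.mem_inter, Finset.mem_insert, Finset.mem_singleton,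
    Prod.mk.injEq]
  omega

lemma adjacent_up_down_left (i j : ℤ) : Adjacent (.up (i + 1) j) (.down i j) := by
  refine Finset.card_eq_two.2 ⟨(i + 1, j), (i + 1, j + 1), by simp, ?_⟩
  ext ⟨x, y⟩
  simp only [Triangle.vertices, Finset.mem_inter, Finset.mem_insert, Finset.mem_singleton,
    Prod.mk.injEq]
  omega

lemma adjacent_up_down_below (i j : ℤ) : Adjacent (.up i j) (.down i (j + 1)) := by
  refine Finset.card_eq_two.2 ⟨(i, j + 1), (i + 1, j + 1), by simp, ?_⟩
  ext ⟨x, y⟩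
  simp only [Triangle.vertices, Finset.mem_inter, Finset.mem_insert, Finset.mem_singleton,
    Prod.mk.injEq]
  omega

/-- The neighbours of an up-pointing triangle are down-pointing and lie in its row or in the next
row to the south. -/
lemma Adjacent.exists_eq_down {i j : ℤ} {q : Triangle} (h : Adjacent (.up i j) q) :
    ∃ i' j', q = .down i' j' ∧ j ≤ j' := by
  obtain ⟨⟨x, y⟩, ⟨x', y'⟩, hne, he⟩ := Finset.card_eq_two.1 h
  have h₁ : (x, y) ∈ (Triangle.up i j).vertices ∩ q.vertices := by simp [he]
  have h₂ : (x', y') ∈ (Triangle.up i j).vertices ∩ q.vertices := by simp [he]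
  rw [Finset.mem_inter] at h₁ h₂
  cases q with
  | up i' j' =>
    exfalso
    -- two distinct common corners force the two up-pointing triangles to coincide
    have key : i = i' ∧ j = j' := by
      simp only [Triangle.vertices, Finset.mem_insert, Finset.mem_singleton,
        Prod.mk.injEq, ne_eq] at h₁ h₂ hne
      omega
    obtain ⟨rfl, rfl⟩ := key
    exact h.ne rfl
  | down i' j' =>
    refine ⟨i', j', rfl, ?_⟩
    simp only [Triangle.vertices, Finset.mem_insert, Finset.mem_singleton,
      Prod.mk.injEq, ne_eq] at h₁ h₂ hne
    omega

/-- A region is tileable if it carries an involution that maps every triangle to a neighbour. -/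
lemma tileable_of_involution {R : Set Triangle} (g : Triangle → Triangle)
    (hR : ∀ p ∈ R, g p ∈ R) (hg : Function.Involutive g) (hadj : ∀ p ∈ R, Adjacent p (g p)) :
    Tileable R := by
  refine ⟨{L | ∃ p ∈ R, L = {p, g p}}, ?_, ?_, ?_, ?_⟩
  · rintro L ⟨p, hp, rfl⟩
    exact ⟨p, g p, hadj p hp, rfl⟩
  · rintro L ⟨p, hp, rfl⟩ x (rfl | rfl)
    exacts [hp, hR p hp]
  · rintro L ⟨p, -, rfl⟩ L' ⟨q, -, rfl⟩ hne
    -- by involutivity, a lozenge is determined by either of its triangles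
    have key : ∀ p x, x ∈ ({p, g p} : Set Triangle) → ({p, g p} : Set Triangle) = {x, g x} := by
      rintro p x (rfl | rfl)
      · rfl
      · rw [hg p, Set.pair_comm]
    refine Set.disjoint_left.2 fun x hx hx' => hne ?_
    rw [key p x hx, key q x hx']
  · intro p hp
    exact ⟨{p, g p}, ⟨p, hp, rfl⟩, by simp⟩

/-- A tiling of a region induces an injective map of its triangles that maps every triangle to a
neighbour within the region, namely to the other triangle of its lozenge. -/
lemma Tileable.exists_injOn {R : Set Triangle} (h : Tileable R) :
    ∃ f : Triangle → Triangle, (∀ p ∈ R, f p ∈ R ∧ Adjacent p (f p)) ∧ Set.InjOn f R := by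
  obtain ⟨T, hT⟩ := h
  have key : ∀ p, ∃ q, p ∈ R → ({p, q} : Set Triangle) ∈ T ∧ Adjacent p q := by
    intro p
    by_cases hp : p ∈ R
    · obtain ⟨L, hL, hpL⟩ := hT.covers p hp
      obtain ⟨x, y, hxy, rfl⟩ := hT.isLozenge L hL
      rcases hpL with rfl | rfl
      · exact ⟨y, fun _ => ⟨hL, hxy⟩⟩
      · exact ⟨x, fun _ => ⟨by rwa [Set.pair_comm], hxy.symm⟩⟩
    · exact ⟨p, fun h => absurd h hp⟩
  choose f hf using key
  refine ⟨f, fun p hp => ⟨hT.subset _ (hf p hp).1 (by simp), (hf p hp).2⟩, ?_⟩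
  intro p hp q hq hpq
  have hL : ({p, f p} : Set Triangle) = {q, f q} := by
    by_contra hne
    exact Set.disjoint_left.1 (hT.pairwiseDisjoint (hf p hp).1 (hf q hq).1 hne)
      (show f p ∈ _ by simp) (show f p ∈ _ by simp [hpq])
  have hmem : p ∈ ({q, f q} : Set Triangle) := hL ▸ Set.mem_insert _ _
  rcases hmem with h | h
  · exact h
  · exact absurd (h.trans hpq.symm) (hf p hp).2.ne

/-! ### Coordinates of the dented half-hexagon -/

section

variable {a b n : ℕ} {u : Fin n → ℕ}

/-- The dents of the northeastern side do not matter west of the axis. -/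
lemma up_mem_dentedHalfHexagon (hu : ∀ l, 1 ≤ u l) {i j : ℤ} :
    Triangle.up i j ∈ dentedHalfHexagon a b n u ↔
      0 ≤ j ∧ j + 1 ≤ 2 * b + 2 * n ∧ 0 ≤ i ∧ j + 1 ≤ i + (b + 2 * n) ∧ 2 * i + 1 ≤ 2 * a + j ∧
        ∀ l, i = 0 → j + 1 ≠ u l := by
  simp only [dentedHalfHexagon, dentedHexagon, hexagon, InHexagon, Set.mem_ofPred_eq,
    Triangle.vertices, Finset.mem_insert, Finset.mem_singleton, forall_eq_or_imp, forall_eq,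
    neTriangle, nwTriangle, ne_eq, Triangle.up.injEq, Nat.cast_mul, Nat.cast_ofNat]
  constructor
  · rintro ⟨⟨h₁, -, h₂⟩, h₃⟩
    refine ⟨by omega, by omega, by omega, by omega, by omega, fun l hi hj => h₂ l ?_⟩
    omega
  · rintro ⟨h₁, h₂, h₃, h₄, h₅, h₆⟩
    refine ⟨⟨by omega, fun l h => ?_, fun l h => h₆ l h.1 (by omega)⟩, by omega⟩
    have := hu l
    omega

lemma down_mem_dentedHalfHexagon {i j : ℤ} :
    Triangle.down i j ∈ dentedHalfHexagon a b n u ↔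
      0 ≤ j ∧ j + 1 ≤ 2 * b + 2 * n ∧ 0 ≤ i ∧ j ≤ i + (b + 2 * n) ∧ 2 * i + 2 ≤ 2 * a + j := by
  simp only [dentedHalfHexagon, dentedHexagon, hexagon, InHexagon, Set.mem_ofPred_eq,
    Triangle.vertices, Finset.mem_insert, Finset.mem_singleton, forall_eq_or_imp, forall_eq,
    neTriangle, nwTriangle, ne_eq, reduceCtorEq, not_false_eq_true, implies_true, and_true,
    Nat.cast_mul, Nat.cast_ofNat]
  omega

/-! ### Necessity -/

/-- The number of positions on the horizontal line `j` at which a vertical lozenge of the half of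
the hexagon (dents disregarded) may cross that line, where `N` is the length of the northwestern
side. It is both the number of down-pointing triangles in row `j` and, for `j ≥ 1`, the number of
up-pointing triangles in row `j - 1`. -/
def lineWidth (a N j : ℕ) : ℕ := a + j / 2 - (j - N)

lemma sum_Ico_succ_add (w : ℕ → ℕ) {k m : ℕ} (h : k ≤ m) :
    ∑ j ∈ Finset.Ico k m, w (j + 1) + w k = ∑ j ∈ Finset.Ico k m, w j + w m := by
  induction m, h using Nat.le_induction with
  | base => simp
  | succ m hm ih =>
    rw [Finset.sum_Ico_succ_top hm, Finset.sum_Ico_succ_top hm]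
    omega

/-- In a tileable half-hexagon, the up-pointing triangles south of line `u i` number at most as
many as the down-pointing ones. -/
lemma two_mul_le_of_tileable (hu : StrictMono u) (hu_mem : ∀ i, 1 ≤ u i ∧ u i ≤ b + 2 * n)
    (h : Tileable (dentedHalfHexagon a b n u)) (i : Fin n) : 2 * ((i : ℕ) + 1) ≤ u i := by
  classical
  obtain ⟨f, hf, hinj⟩ := h.exists_injOn
  set k := u i with hk
  have hk₁ : k ≤ b + 2 * n := (hu_mem i).2
  have hi := i.isLt
  -- the up-pointing triangles from row `k` on, dents included
  let U : Finset Triangle := ((Finset.Ico k (2 * b + 2 * n)).sigma fun j =>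
    Finset.Ico (j + 1 - (b + 2 * n)) (a + (j + 1) / 2)).image fun x => .up (x.2 : ℤ) (x.1 : ℤ)
  let E : Finset Triangle := ((Finset.Ico k (2 * b + 2 * n)).sigma fun j =>
    Finset.Ico (j - (b + 2 * n)) (a + j / 2)).image fun x => .down (x.2 : ℤ) (x.1 : ℤ)
  let X : Finset Triangle := (Finset.Ioi i).image fun l => nwTriangle (u l)
  have hU : U.card = ∑ j ∈ Finset.Ico k (2 * b + 2 * n), lineWidth a (b + 2 * n) (j + 1) := by
    rw [Finset.card_image_of_injective, Finset.card_sigma]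
    · simp [lineWidth]
    · rintro ⟨x, y⟩ ⟨x', y'⟩ hxy
      simp only [Triangle.up.injEq, Nat.cast_inj] at hxy
      obtain ⟨rfl, rfl⟩ := hxy
      rfl
  have hE : E.card ≤ ∑ j ∈ Finset.Ico k (2 * b + 2 * n), lineWidth a (b + 2 * n) j := by
    refine Finset.card_image_le.trans (le_of_eq ?_)
    rw [Finset.card_sigma]
    simp [lineWidth]
  have hX : X.card ≤ n - 1 - i := by
    refine Finset.card_image_le.trans (le_of_eq ?_)
    simp
  have hsub : ∀ p ∈ U \ X, p ∈ dentedHalfHexagon a b n u := by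
    intro p hp
    obtain ⟨hpU, hpX⟩ := Finset.mem_sdiff.1 hp
    obtain ⟨⟨y, x⟩, hxy, rfl⟩ := Finset.mem_image.1 hpU
    simp only [Finset.mem_sigma, Finset.mem_Ico] at hxy
    dsimp only at hpX ⊢
    refine (up_mem_dentedHalfHexagon fun l => (hu_mem l).1).2
      ⟨by omega, by omega, by omega, by omega, by omega, fun l hx hl => hpX ?_⟩
    have hil : i < l := by
      rw [← hu.lt_iff_lt]
      omega
    refine Finset.mem_image.2 ⟨l, Finset.mem_Ioi.2 hil, ?_⟩
    simp only [nwTriangle, Triangle.up.injEq]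
    omega
  have hmaps : ∀ p ∈ U \ X, f p ∈ E := by
    intro p hp
    obtain ⟨hR, hadj⟩ := hf p (hsub p hp)
    obtain ⟨⟨y, x⟩, hxy, rfl⟩ := Finset.mem_image.1 (Finset.mem_sdiff.1 hp).1
    simp only [Finset.mem_sigma, Finset.mem_Ico] at hxy
    obtain ⟨x', y', he, hy⟩ := hadj.exists_eq_down
    rw [he, down_mem_dentedHalfHexagon] at hR
    dsimp only at hy
    rw [he]
    refine Finset.mem_image.2 ⟨⟨y'.toNat, x'.toNat⟩, ?_, ?_⟩
    · simp only [Finset.mem_sigma, Finset.mem_Ico]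
      omega
    · simp only [Triangle.down.injEq]
      omega
  have hcard := Finset.card_le_card_of_injOn f hmaps (hinj.mono hsub)
  have hdiff := Finset.le_card_sdiff X U
  have htel := sum_Ico_succ_add (lineWidth a (b + 2 * n)) (show k ≤ 2 * b + 2 * n by omega)
  have hwk : lineWidth a (b + 2 * n) k = a + k / 2 := by
    unfold lineWidth; omega
  have hwm : lineWidth a (b + 2 * n) (2 * b + 2 * n) = a + n := by
    unfold lineWidth; omega
  omega

/-! ### Sufficiency -/

/-- The matching of up-pointing with down-pointing triangles given by a function `q`: vertical
lozenges cross the horizontal line `j` at all positions `i ≥ q j`, and the triangles of row `j` west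
of them are matched along the row, with displacement `q (j + 1) - q j`. -/
def rowMatching (q : ℤ → ℤ) : Triangle → Triangle
  | .up i j => if i < q (j + 1) then .down (i - (q (j + 1) - q j)) j else .down i (j + 1)
  | .down i j => if i < q j then .up (i + (q (j + 1) - q j)) j else .up i (j - 1)

lemma rowMatching_involutive (q : ℤ → ℤ) : Function.Involutive (rowMatching q) := by
  rintro (⟨i, j⟩ | ⟨i, j⟩)
  · by_cases h : i < q (j + 1)
    · have h' : i - (q (j + 1) - q j) < q j := by omega
      simp [rowMatching, h, h']
    · simp [rowMatching, h]
  · by_cases h : i < q j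
    · have h' : i + (q (j + 1) - q j) < q (j + 1) := by omega
      simp [rowMatching, h, h']
    · simp [rowMatching, h]

lemma adjacent_rowMatching {q : ℤ → ℤ} (hq : ∀ j, q (j + 1) = q j ∨ q (j + 1) = q j + 1)
    (p : Triangle) : Adjacent p (rowMatching q p) := by
  cases p with
  | up i j =>
    by_cases h : i < q (j + 1)
    · rcases hq j with h' | h'
      · rw [h'] at h
        simpa [rowMatching, h, h'] using adjacent_up_down i j
      · rw [h'] at h
        simpa [rowMatching, h, h'] using adjacent_up_down_left (i - 1) j
    · simpa [rowMatching, h] using adjacent_up_down_below i j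
  | down i j =>
    by_cases h : i < q j
    · rcases hq j with h' | h'
      · simpa [rowMatching, h, h'] using (adjacent_up_down i j).symm
      · simpa [rowMatching, h, h'] using (adjacent_up_down_left i j).symm
    · simpa [rowMatching, h] using (adjacent_up_down_below i (j - 1)).symm

/-- The position from which on vertical lozenges cross line `j`: it moves one step east at every
dent, and in every row in which the region recedes from the line `i = 0`. -/
def front (a b : ℕ) (u : Fin n → ℕ) (j : ℤ) : ℤ :=
  a + (Finset.univ.filter fun l => (u l : ℤ) ≤ j).card + max 0 (j - (b + 2 * n))

lemma front_succ_of_dent (hu : StrictMono u) (hu_mem : ∀ i, 1 ≤ u i ∧ u i ≤ b + 2 * n) {j : ℤ}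
    {l : Fin n} (hl : j + 1 = u l) : front a b u (j + 1) = front a b u j + 1 := by
  have h₁ : (Finset.univ.filter fun m => (u m : ℤ) ≤ j + 1) =
      insert l (Finset.univ.filter fun m => (u m : ℤ) ≤ j) := by
    ext m
    have := hu.injective.eq_iff (a := m) (b := l)
    simp only [Finset.mem_filter, Finset.mem_univ, true_and, Finset.mem_insert, ← this]
    omega
  have h₂ := (hu_mem l).2
  rw [front, front, h₁, Finset.card_insert_of_notMem (by simp; omega)]
  push_cast
  omega

lemma front_succ_of_not_dent {j : ℤ} (hl : ∀ l, j + 1 ≠ u l) :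
    front a b u (j + 1) = front a b u j + if (b : ℤ) + 2 * n ≤ j then 1 else 0 := by
  have h₁ : (Finset.univ.filter fun m => (u m : ℤ) ≤ j + 1) =
      Finset.univ.filter fun m => (u m : ℤ) ≤ j := by
    refine Finset.filter_congr fun m _ => ?_
    have := hl m
    omega
  rw [front, front, h₁]
  split_ifs <;> omega

lemma front_nonneg (j : ℤ) : 0 ≤ front a b u j := by
  unfold front
  positivity

lemma front_zero (hu_mem : ∀ i, 1 ≤ u i ∧ u i ≤ b + 2 * n) : front a b u 0 = a := by
  have : (Finset.univ.filter fun m => (u m : ℤ) ≤ 0) = ∅ := by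
    refine Finset.filter_eq_empty_iff.2 fun m _ => ?_
    have := hu_mem m
    omega
  rw [front, this]
  simp
  omega

lemma front_bottom (hu_mem : ∀ i, 1 ≤ u i ∧ u i ≤ b + 2 * n) :
    front a b u (2 * b + 2 * n) = a + b + n := by
  have : (Finset.univ.filter fun m => (u m : ℤ) ≤ 2 * b + 2 * n) = Finset.univ := by
    refine Finset.filter_eq_self.2 fun m _ => ?_
    have := hu_mem m
    omega
  rw [front, this]
  simp
  omega

/-- The front does not pass the vertical axis; the hypothesis on the dents is used here only. -/
lemma two_mul_front_le (h : ∀ i : Fin n, 2 * ((i : ℕ) + 1) ≤ u i) {j : ℤ}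
    (hj : 0 ≤ j) (hj' : j ≤ 2 * b + 2 * n) : 2 * front a b u j ≤ 2 * a + j := by
  have hn : (Finset.univ.filter fun m => (u m : ℤ) ≤ j).card ≤ n :=
    (Finset.card_le_univ _).trans_eq (Fintype.card_fin n)
  have hc : (2 * (Finset.univ.filter fun m => (u m : ℤ) ≤ j).card : ℤ) ≤ j := by
    rcases (Finset.univ.filter fun m => (u m : ℤ) ≤ j).eq_empty_or_nonempty with he | he
    · simpa [he] using hj
    · -- if `m` is the last dent above line `j`, then there are at most `m + 1` dents above line `j`
      set m := Finset.max' _ he with hm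
      have hmj := (Finset.mem_filter.1 (Finset.max'_mem _ he)).2
      rw [← hm] at hmj
      have hsub : (Finset.univ.filter fun m => (u m : ℤ) ≤ j) ⊆ Finset.Iic m := fun l hl =>
        Finset.mem_Iic.2 (Finset.le_max' _ l hl)
      have hcard := Finset.card_le_card hsub
      rw [Fin.card_Iic] at hcard
      have := h m
      omega
  unfold front
  omega

lemma tileable_of_two_mul_le (hu : StrictMono u) (hu_mem : ∀ i, 1 ≤ u i ∧ u i ≤ b + 2 * n)
    (h : ∀ i : Fin n, 2 * ((i : ℕ) + 1) ≤ u i) : Tileable (dentedHalfHexagon a b n u) := by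
  have hstep : ∀ j, front a b u (j + 1) = front a b u j ∧ j < b + 2 * n ∧ (∀ l, j + 1 ≠ u l) ∨
      front a b u (j + 1) = front a b u j + 1 ∧ ((b : ℤ) + 2 * n ≤ j ∨ ∃ l, j + 1 = u l) := by
    intro j
    by_cases hl : ∃ l, j + 1 = (u l : ℤ)
    · obtain ⟨l, hl⟩ := hl
      exact Or.inr ⟨front_succ_of_dent hu hu_mem hl, Or.inr ⟨l, hl⟩⟩
    · have hl' : ∀ l, j + 1 ≠ (u l : ℤ) := fun l h => hl ⟨l, h⟩
      have hs := front_succ_of_not_dent (a := a) (b := b) hl'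
      split_ifs at hs with hj
      · exact Or.inr ⟨hs, Or.inl hj⟩
      · exact Or.inl ⟨by omega, by omega, hl'⟩
  have hzero := front_zero (a := a) hu_mem
  have hbot := front_bottom (a := a) hu_mem
  have hu₁ : ∀ l, 1 ≤ u l := fun l => (hu_mem l).1
  have hadj := adjacent_rowMatching (q := front a b u) fun j =>
    (hstep j).imp And.left And.left
  refine tileable_of_involution (rowMatching (front a b u)) ?_ (rowMatching_involutive _)
    fun p _ => hadj p
  rintro (⟨i, j⟩ | ⟨i, j⟩) hp
  · rw [up_mem_dentedHalfHexagon hu₁] at hp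
    obtain ⟨h₁, h₂, h₃, h₄, h₅, h₆⟩ := hp
    simp only [rowMatching]
    split_ifs with hi
    · rw [down_mem_dentedHalfHexagon]
      have hle := two_mul_front_le (a := a) (b := b) h h₁ (by omega)
      rcases hstep j with ⟨hs, hj, -⟩ | ⟨hs, hj | ⟨l, hl⟩⟩
      · omega
      · omega
      · have : i ≠ 0 := fun h0 => h₆ l h0 hl
        have := (hu_mem l).2
        omega
    · rw [down_mem_dentedHalfHexagon]
      have hj : j + 1 ≠ 2 * b + 2 * n := by
        intro hj
        rw [hj] at hi
        omega
      omega
  · rw [down_mem_dentedHalfHexagon] at hp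
    obtain ⟨h₁, h₂, h₃, h₄, h₅⟩ := hp
    simp only [rowMatching]
    split_ifs with hi
    · rw [up_mem_dentedHalfHexagon hu₁]
      have hle := two_mul_front_le (a := a) (b := b) h (j := j + 1) (by omega) (by omega)
      rcases hstep j with ⟨hs, hj, hl⟩ | ⟨hs, hj⟩
      · exact ⟨by omega, by omega, by omega, by omega, by omega, fun l _ => hl l⟩
      · exact ⟨by omega, by omega, by omega, by omega, by omega, fun l _ => by omega⟩
    · rw [up_mem_dentedHalfHexagon hu₁]
      have hj : j ≠ 0 := by
        rintro rfl
        omega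
      refine ⟨by omega, by omega, by omega, by omega, by omega, fun l h0 hl => ?_⟩
      -- below a dent at the western end of row `j - 1`, the front is positive
      have hs := front_succ_of_dent (a := a) hu hu_mem hl
      have := front_nonneg (a := a) (b := b) (u := u) (j - 1)
      rw [sub_add_cancel] at hs
      omega

end

end Lozenge

theorem mainTheorem6 (a b n : ℕ) (u : Fin n → ℕ) (hu : StrictMono u)
    (hu_mem : ∀ i, 1 ≤ u i ∧ u i ≤ b + 2 * n) :
    Lozenge.Tileable (Lozenge.dentedHalfHexagon a b n u) ↔
      ∀ i : Fin n, 2 * ((i : ℕ) + 1) ≤ u i :=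
  ⟨Lozenge.two_mul_le_of_tileable hu hu_mem, Lozenge.tileable_of_two_mul_le hu hu_mem⟩
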